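/- Let $C$ be a unital abelian C$^*$-algebra with spectrum (character space) $\Delta$. A Banach $C$-bimodule $X$ is called \emph{central} if $cx=xc$ for all $c\in C$, $x\in X$, and \emph{representable} if there exist Hilbert spaces $\mathcal H,\mathcal K$ with $*$-representations $\pi:C\to B(\mathcal H)$, $\sigma:C\to B(\mathcal K)$ and a linear isometry $\Phi:X\to B(\mathcal K,\mathcal H)$ such that $\Phi(cx)=\pi(c)\Phi(x)$ and $\Phi(xc)=\Phi(x)\sigma(c)$ for all $c\in C$, $x\in X$. Let $X,Y$ be central representable (unital) Banach $C$-bimodules. For $t\in\Delta$ let $C_t=\ker t$, let $X(t)=X/[C_tX]$ be the quotient Banach space by the closed linear span $[C_tX]$ of $\{cx: c\in C_t,\ x\in X\}$, and denote by $x(t)$ the coset of $x\in X$ in $X(t)$; similarly for $Y$. Let $\stackrel{\gamma}{\otimes}$ denote the (completed) projective tensor product of Banach spaces, and let $X\stackrel{\gamma}{\otimes}_C Y$ be the quotient of $X\stackrel{\gamma}{\otimes}Y$ by the closed linear span of all elements $xc\otimes y-x\otimes cy$ ($x\in X$, $y\in Y$, $c\in C$), with the quotient norm; write $x\otimes_C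 y$ for the class of $x\otimes y$. It is a Banach $C$-bimodule with $c(x\otimes_C y)=cx\otimes_C y$ and $(x\otimes_C y)c=x\otimes_C yc$. Let $\oplus_{t\in\Delta}$ denote the $\ell^\infty$-direct sum (all bounded families, with the supremum norm). Then the natural contraction $$\kappa: X\stackrel{\gamma}{\otimes}_C Y\to\oplus_{t\in\Delta}\bigl(X(t)\stackrel{\gamma}{\otimes}Y(t)\bigr),\qquad \kappa(x\otimes_C y)=(x(t)\otimes y(t))_{t\in\Delta},$$ is isometric. Consequently $X\stackrel{\gamma}{\otimes}_C Y$ is a representable $C$-bimodule. -/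

import Mathlib

open scoped TensorProduct ENNReal

universe uC uX uY w₁ w₂


noncomputable section

namespace CentralBimodule

/-! ### Representable bimodules -/

/-- A Banach `A,B`-bimodule `X` (left action of `A`, right action of `B` written as an action of
`Bᵐᵒᵖ`) is representable if there are Hilbert spaces `H`, `K`, `*`-representations `π` of `A` on `H`
and `σ` of `B` on `K`, and an isometric `A,B`-bimodule homomorphism `X → B(K, H)`. -/
def IsRepresentable.{w, a, b, x} (A : Type a) (B : Type b) [CStarAlgebra A] [CStarAlgebra B]
    (X : Type x) [NormedAddCommGroup X] [NormedSpace ℂ X] [Module A X] [Module Bᵐᵒᵖ X] : Prop :=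
  ∃ (H : Type w) (_ : NormedAddCommGroup H) (_ : InnerProductSpace ℂ H) (_ : CompleteSpace H)
    (K : Type w) (_ : NormedAddCommGroup K) (_ : InnerProductSpace ℂ K) (_ : CompleteSpace K)
    (π : A →⋆ₐ[ℂ] (H →L[ℂ] H)) (σ : B →⋆ₐ[ℂ] (K →L[ℂ] K)) (Φ : X →ₗᵢ[ℂ] (K →L[ℂ] H)),
    (∀ (a : A) (x : X), Φ (a • x) = π a ∘L Φ x) ∧
      ∀ (b : B) (x : X), Φ (MulOpposite.op b • x) = Φ x ∘L σ b

/-! ### The projective tensor product of Banach spaces -/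

section Projective

variable (X Y : Type*) [SeminormedAddCommGroup X] [NormedSpace ℂ X]
  [SeminormedAddCommGroup Y] [NormedSpace ℂ Y]

/-- The algebraic tensor product, as a carrier for the projective norm. -/
def AlgTensor : Type _ := X ⊗[ℂ] Y

instance : AddCommGroup (AlgTensor X Y) := inferInstanceAs (AddCommGroup (X ⊗[ℂ] Y))

instance : Module ℂ (AlgTensor X Y) := inferInstanceAs (Module ℂ (X ⊗[ℂ] Y))

variable {X Y}

/-- The numbers `∑ ‖xᵢ‖ ‖yᵢ‖`, over all representations `w = ∑ xᵢ ⊗ yᵢ`. -/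
def projCosts (w : X ⊗[ℂ] Y) : Set ℝ :=
  {r | ∃ (n : ℕ) (x : Fin n → X) (y : Fin n → Y),
    w = ∑ i, x i ⊗ₜ[ℂ] y i ∧ r = ∑ i, ‖x i‖ * ‖y i‖}

/-- The projective norm `γ(w) = inf {∑ ‖xᵢ‖ ‖yᵢ‖ : w = ∑ xᵢ ⊗ yᵢ}`. -/
def projNorm (w : X ⊗[ℂ] Y) : ℝ := sInf (projCosts w)

theorem projCosts_nonneg {w : X ⊗[ℂ] Y} {r : ℝ} (hr : r ∈ projCosts w) : 0 ≤ r := by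
  obtain ⟨n, x, y, -, rfl⟩ := hr
  positivity

theorem projCosts_bddBelow (w : X ⊗[ℂ] Y) : BddBelow (projCosts w) :=
  ⟨0, fun _ hr => projCosts_nonneg hr⟩

theorem projCosts_add {v w : X ⊗[ℂ] Y} {r s : ℝ} (hr : r ∈ projCosts v) (hs : s ∈ projCosts w) :
    r + s ∈ projCosts (v + w) := by
  obtain ⟨n, x, y, rfl, rfl⟩ := hr
  obtain ⟨m, x', y', rfl, rfl⟩ := hs
  refine ⟨n + m, Fin.append x x', Fin.append y y', ?_, ?_⟩ <;> simp [Fin.sum_univ_add]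

theorem projCosts_tmul (x : X) (y : Y) : ‖x‖ * ‖y‖ ∈ projCosts (x ⊗ₜ[ℂ] y) :=
  ⟨1, fun _ => x, fun _ => y, by simp, by simp⟩

theorem projCosts_zero : (0 : ℝ) ∈ projCosts (0 : X ⊗[ℂ] Y) :=
  ⟨0, Fin.elim0, Fin.elim0, by simp, by simp⟩

theorem projCosts_nonempty (w : X ⊗[ℂ] Y) : (projCosts w).Nonempty := by
  induction w with
  | zero => exact ⟨0, projCosts_zero⟩
  | tmul x y => exact ⟨_, projCosts_tmul x y⟩
  | add v w hv hw =>
    obtain ⟨r, hr⟩ := hv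
    obtain ⟨s, hs⟩ := hw
    exact ⟨r + s, projCosts_add hr hs⟩

theorem projNorm_le {w : X ⊗[ℂ] Y} {r : ℝ} (hr : r ∈ projCosts w) : projNorm w ≤ r :=
  csInf_le (projCosts_bddBelow w) hr

theorem projNorm_nonneg (w : X ⊗[ℂ] Y) : 0 ≤ projNorm w :=
  Real.sInf_nonneg fun _ hr => projCosts_nonneg hr

theorem projNorm_zero : projNorm (0 : X ⊗[ℂ] Y) = 0 :=
  le_antisymm (projNorm_le projCosts_zero) (projNorm_nonneg _)

theorem projNorm_add_le (v w : X ⊗[ℂ] Y) : projNorm (v + w) ≤ projNorm v + projNorm w := by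
  refine le_of_forall_pos_le_add fun ε hε => ?_
  obtain ⟨r, hr, hr'⟩ := exists_lt_of_csInf_lt (projCosts_nonempty v)
    (show sInf (projCosts v) < projNorm v + ε / 2 by unfold projNorm; linarith)
  obtain ⟨s, hs, hs'⟩ := exists_lt_of_csInf_lt (projCosts_nonempty w)
    (show sInf (projCosts w) < projNorm w + ε / 2 by unfold projNorm; linarith)
  linarith [projNorm_le (projCosts_add hr hs)]

variable {X' Y' : Type*} [SeminormedAddCommGroup X'] [NormedSpace ℂ X']
  [SeminormedAddCommGroup Y'] [NormedSpace ℂ Y']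

theorem projNorm_map_le (f : X →L[ℂ] X') (g : Y →L[ℂ] Y') (w : X ⊗[ℂ] Y) :
    projNorm (TensorProduct.map f.toLinearMap g.toLinearMap w) ≤ ‖f‖ * ‖g‖ * projNorm w := by
  have key : ∀ r ∈ projCosts w,
      projNorm (TensorProduct.map f.toLinearMap g.toLinearMap w) ≤ ‖f‖ * ‖g‖ * r := by
    rintro r ⟨n, x, y, rfl, rfl⟩
    refine (projNorm_le ⟨n, fun i => f (x i), fun i => g (y i), by simp [map_sum], rfl⟩).trans ?_
    rw [Finset.mul_sum]
    refine Finset.sum_le_sum fun i _ => ?_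
    calc ‖f (x i)‖ * ‖g (y i)‖ ≤ (‖f‖ * ‖x i‖) * (‖g‖ * ‖y i‖) :=
          mul_le_mul (f.le_opNorm _) (g.le_opNorm _) (norm_nonneg _) (by positivity)
      _ = ‖f‖ * ‖g‖ * (‖x i‖ * ‖y i‖) := by ring
  rw [projNorm, projNorm, ← smul_eq_mul (‖f‖ * ‖g‖), ← Real.sInf_smul_of_nonneg (by positivity)]
  refine le_csInf ((projCosts_nonempty w).smul_set) ?_
  rintro _ ⟨r, hr, rfl⟩
  exact key r hr

theorem projNorm_smul_le (c : ℂ) (w : X ⊗[ℂ] Y) : projNorm (c • w) ≤ ‖c‖ * projNorm w := by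
  have key : ∀ r ∈ projCosts w, projNorm (c • w) ≤ ‖c‖ * r := by
    rintro r ⟨n, x, y, rfl, rfl⟩
    exact projNorm_le ⟨n, fun i => c • x i, y, by simp [Finset.smul_sum, TensorProduct.smul_tmul'],
      by simp [Finset.mul_sum, norm_smul, mul_assoc]⟩
  rw [projNorm, projNorm, ← smul_eq_mul ‖c‖, ← Real.sInf_smul_of_nonneg (by positivity)]
  refine le_csInf ((projCosts_nonempty w).smul_set) ?_
  rintro _ ⟨r, hr, rfl⟩
  exact key r hr

variable (X Y)

/-- The projective norm as a seminorm on the algebraic tensor product. -/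
def projSeminorm : Seminorm ℂ (AlgTensor X Y) :=
  Seminorm.ofSMulLE (fun w => projNorm (X := X) (Y := Y) w) projNorm_zero projNorm_add_le
    projNorm_smul_le

instance : SeminormedAddCommGroup (AlgTensor X Y) :=
  AddGroupSeminorm.toSeminormedAddCommGroup (projSeminorm X Y).toAddGroupSeminorm

instance : NormedSpace ℂ (AlgTensor X Y) := ⟨projNorm_smul_le (X := X) (Y := Y)⟩

/-- The Banach space projective tensor product: the completion of the algebraic tensor product
in the projective norm. -/
abbrev ProjTensor : Type _ := UniformSpace.Completion (AlgTensor X Y)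

variable {X Y}

/-- The elementary tensor `x ⊗ y` in the projective tensor product. -/
def ptmul (x : X) (y : Y) : ProjTensor X Y :=
  ((show AlgTensor X Y from x ⊗ₜ[ℂ] y : AlgTensor X Y) : UniformSpace.Completion (AlgTensor X Y))

/-- The map `f ⊗ g` on algebraic tensor products, bounded for the projective norms. -/
def algMap (f : X →L[ℂ] X') (g : Y →L[ℂ] Y') : AlgTensor X Y →L[ℂ] AlgTensor X' Y' :=
  LinearMap.mkContinuous (TensorProduct.map f.toLinearMap g.toLinearMap :
    X ⊗[ℂ] Y →ₗ[ℂ] X' ⊗[ℂ] Y') (‖f‖ * ‖g‖) (projNorm_map_le f g)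

/-- The map `f ⊗ g` on projective tensor products. -/
def ptmap (f : X →L[ℂ] X') (g : Y →L[ℂ] Y') : ProjTensor X Y →L[ℂ] ProjTensor X' Y' :=
  (algMap f g).completion

theorem ptmap_ptmul (f : X →L[ℂ] X') (g : Y →L[ℂ] Y') (x : X) (y : Y) :
    ptmap f g (ptmul x y) = ptmul (f x) (g y) := by
  unfold ptmap ptmul
  rw [ContinuousLinearMap.completion_apply_coe]
  rfl

theorem norm_ptmap_le (f : X →L[ℂ] X') (g : Y →L[ℂ] Y') (w : ProjTensor X Y) :
    ‖ptmap f g w‖ ≤ ‖f‖ * ‖g‖ * ‖w‖ := by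
  induction w using UniformSpace.Completion.induction_on with
  | hp => exact isClosed_le (by fun_prop) (by fun_prop)
  | ih w =>
    unfold ptmap
    rw [ContinuousLinearMap.completion_apply_coe, UniformSpace.Completion.norm_coe,
      UniformSpace.Completion.norm_coe]
    exact projNorm_map_le f g w

theorem ptmul_add (x : X) (y y' : Y) : ptmul x (y + y') = ptmul x y + ptmul x y' := by
  unfold ptmul
  rw [← UniformSpace.Completion.coe_add]
  exact congrArg _ (TensorProduct.tmul_add x y y')

theorem add_ptmul (x x' : X) (y : Y) : ptmul (x + x') y = ptmul x y + ptmul x' y := by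
  unfold ptmul
  rw [← UniformSpace.Completion.coe_add]
  exact congrArg _ (TensorProduct.add_tmul x x' y)

theorem smul_ptmul (c : ℂ) (x : X) (y : Y) : ptmul (c • x) y = c • ptmul x y := by
  unfold ptmul
  rw [← UniformSpace.Completion.coe_smul]
  rfl

theorem ptmul_smul (c : ℂ) (x : X) (y : Y) : ptmul x (c • y) = c • ptmul x y := by
  unfold ptmul
  rw [← UniformSpace.Completion.coe_smul]
  exact congrArg _ (TensorProduct.tmul_smul c x y)

theorem projTensor_ext {E : Type*} [AddCommGroup E] [Module ℂ E] [TopologicalSpace E] [T2Space E]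
    {f g : ProjTensor X Y →L[ℂ] E} (h : ∀ x y, f (ptmul x y) = g (ptmul x y)) : f = g := by
  have h1 : (f ∘L UniformSpace.Completion.toComplL).toLinearMap =
      (g ∘L (UniformSpace.Completion.toComplL (𝕜 := ℂ) (E := AlgTensor X Y))).toLinearMap :=
    TensorProduct.ext' (R := ℂ) (M := X) (N := Y) h
  ext w
  induction w using UniformSpace.Completion.induction_on with
  | hp => exact isClosed_eq (by fun_prop) (by fun_prop)
  | ih w => exact LinearMap.congr_fun h1 w

end Projective

/-! ### Fibres over the spectrum -/

section Fiber

variable (C : Type*) [CommCStarAlgebra C] (X : Type*) [NormedAddCommGroup X] [NormedSpace ℂ X]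
  [Module C X] (t : WeakDual.characterSpace ℂ C)

/-- The closed linear span `[C_t X]`, where `C_t` is the kernel of the character `t`. -/
def fiberKer : Submodule ℂ X :=
  (Submodule.span ℂ {v : X | ∃ (c : C) (x : X), t c = 0 ∧ v = c • x}).topologicalClosure

instance : IsClosed (fiberKer C X t : Set X) := Submodule.isClosed_topologicalClosure _

/-- The fibre `X(t) = X / [C_t X]` with the quotient norm. -/
abbrev Fiber : Type _ := X ⧸ fiberKer C X t

variable {X}

/-- The coset `x(t)` of `x` in `X(t)`. -/
def toFiber : X →L[ℂ] Fiber C X t := (fiberKer C X t).mkQL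

theorem norm_toFiber_le : ‖toFiber C (X := X) t‖ ≤ 1 :=
  ContinuousLinearMap.opNorm_le_bound _ zero_le_one fun x => by
    rw [one_mul]
    exact Submodule.Quotient.norm_mk_le (fiberKer C X t) x

variable {C}

theorem toFiber_smul [IsScalarTower ℂ C X] (c : C) (x : X) :
    toFiber C t (c • x) = t c • toFiber C t x := by
  rw [← map_smul, ← sub_eq_zero, ← map_sub]
  refine (Submodule.Quotient.mk_eq_zero _).2 (Submodule.le_topologicalClosure _
    (Submodule.subset_span ⟨c - algebraMap ℂ C (t c), x, ?_, ?_⟩))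
  · rw [map_sub, AlgHomClass.commutes]
    exact sub_self _
  · rw [sub_smul, algebraMap_smul]

end Fiber

/-! ### The projective tensor product of Banach modules -/

section Balanced

variable (C : Type*) [CommCStarAlgebra C] (X Y : Type*)
  [NormedAddCommGroup X] [NormedSpace ℂ X] [Module Cᵐᵒᵖ X]
  [NormedAddCommGroup Y] [NormedSpace ℂ Y] [Module C Y]

/-- The closed linear span in the projective tensor product of all `xc ⊗ y - x ⊗ cy`. -/
def balancedKer : Submodule ℂ (ProjTensor X Y) :=
  (Submodule.span ℂ {v | ∃ (x : X) (c : C) (y : Y),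
    v = ptmul (MulOpposite.op c • x) y - ptmul x (c • y)}).topologicalClosure

instance : IsClosed (balancedKer C X Y : Set (ProjTensor X Y)) :=
  Submodule.isClosed_topologicalClosure _

/-- The Banach module projective tensor product over `C`: the quotient of the Banach space
projective tensor product by the closed span of all `xc ⊗ y - x ⊗ cy`, with the quotient norm. -/
def ModTensor : Type _ :=
  ProjTensor X Y ⧸ balancedKer C X Y

instance : NormedAddCommGroup (ModTensor C X Y) :=
  inferInstanceAs (NormedAddCommGroup (ProjTensor X Y ⧸ balancedKer C X Y))

instance : NormedSpace ℂ (ModTensor C X Y) :=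
  inferInstanceAs (NormedSpace ℂ (ProjTensor X Y ⧸ balancedKer C X Y))

instance : CompleteSpace (ModTensor C X Y) :=
  inferInstanceAs (CompleteSpace (ProjTensor X Y ⧸ balancedKer C X Y))

/-- The quotient map onto the module tensor product. -/
def modMk : ProjTensor X Y →L[ℂ] ModTensor C X Y := (balancedKer C X Y).mkQL

variable {X Y}

/-- The elementary tensor `x ⊗_C y`. -/
def mtmul (x : X) (y : Y) : ModTensor C X Y := modMk C X Y (ptmul x y)

theorem mtmul_balanced (x : X) (c : C) (y : Y) :
    mtmul C (MulOpposite.op c • x) y = mtmul C x (c • y) := by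
  unfold mtmul
  rw [← sub_eq_zero, ← map_sub]
  exact (Submodule.Quotient.mk_eq_zero _).2
    (Submodule.le_topologicalClosure _ (Submodule.subset_span ⟨x, c, y, rfl⟩))

variable {C}

theorem modTensor_ext {E : Type*} [AddCommGroup E] [Module ℂ E] [TopologicalSpace E] [T2Space E]
    {f g : ModTensor C X Y →L[ℂ] E} (h : ∀ x y, f (mtmul C x y) = g (mtmul C x y)) : f = g := by
  have h1 : f ∘L modMk C X Y = g ∘L modMk C X Y := projTensor_ext h
  ext z
  obtain ⟨w, rfl⟩ := Submodule.mkQ_surjective (balancedKer C X Y) z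
  exact DFunLike.congr_fun h1 w

variable {E : Type*} [NormedAddCommGroup E] [NormedSpace ℂ E]

theorem balancedKer_le_ker (f : ProjTensor X Y →L[ℂ] E)
    (hf : ∀ x (c : C) y, f (ptmul (MulOpposite.op c • x) y) = f (ptmul x (c • y))) :
    balancedKer C X Y ≤ f.ker := by
  refine Submodule.topologicalClosure_minimal _ (Submodule.span_le.2 ?_) f.isClosed_ker
  rintro _ ⟨x, c, y, rfl⟩
  simpa [sub_eq_zero] using hf x c y

/-- A bounded linear map that is `C`-balanced on elementary tensors descends to the module
tensor product. -/
def modLift (f : ProjTensor X Y →L[ℂ] E)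
    (hf : ∀ x (c : C) y, f (ptmul (MulOpposite.op c • x) y) = f (ptmul x (c • y))) :
    ModTensor C X Y →L[ℂ] E :=
  (balancedKer C X Y).liftQL f (balancedKer_le_ker f hf)

theorem modLift_mtmul (f : ProjTensor X Y →L[ℂ] E)
    (hf : ∀ x (c : C) y, f (ptmul (MulOpposite.op c • x) y) = f (ptmul x (c • y))) (x : X) (y : Y) :
    modLift f hf (mtmul C x y) = f (ptmul x y) := rfl

theorem norm_modLift_le (f : ProjTensor X Y →L[ℂ] E)
    (hf : ∀ x (c : C) y, f (ptmul (MulOpposite.op c • x) y) = f (ptmul x (c • y))) {M : ℝ}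
    (hM0 : 0 ≤ M) (hM : ∀ w, ‖f w‖ ≤ M * ‖w‖) (z : ModTensor C X Y) :
    ‖modLift f hf z‖ ≤ M * ‖z‖ := by
  refine le_of_forall_pos_le_add fun ε hε => ?_
  obtain ⟨w, rfl, hw⟩ := Submodule.Quotient.norm_mk_lt (S := balancedKer C X Y) z
    (show 0 < ε / (M + 1) by positivity)
  refine (hM w).trans ((mul_le_mul_of_nonneg_left hw.le hM0).trans ?_)
  rw [mul_add]
  refine add_le_add le_rfl ?_
  rw [mul_div_assoc', div_le_iff₀ (by positivity)]
  nlinarith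

end Balanced

/-! ### The bimodule structure and the canonical map -/

section Bimodule

/-- The action of a scalar `r` of a normed ring as a bounded operator. -/
def smulL {R X : Type*} [SeminormedRing R] [NormedAddCommGroup X] [NormedSpace ℂ X] [Module R X]
    [IsBoundedSMul R X] [SMulCommClass R ℂ X] (r : R) : X →L[ℂ] X :=
  LinearMap.mkContinuous
    { toFun := fun x => r • x
      map_add' := smul_add r
      map_smul' := fun c x => smul_comm r c x } ‖r‖ (norm_smul_le r)

theorem norm_smulL_le {R X : Type*} [SeminormedRing R] [NormedAddCommGroup X] [NormedSpace ℂ X]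
    [Module R X] [IsBoundedSMul R X] [SMulCommClass R ℂ X] (r : R) : ‖smulL (X := X) r‖ ≤ ‖r‖ :=
  LinearMap.mkContinuous_norm_le _ (norm_nonneg _) _

variable (C : Type*) [CommCStarAlgebra C] (X Y : Type*)
  [NormedAddCommGroup X] [NormedSpace ℂ X] [Module C X] [Module Cᵐᵒᵖ X] [IsScalarTower ℂ C X]
  [IsBoundedSMul C X] [IsCentralScalar C X]
  [NormedAddCommGroup Y] [NormedSpace ℂ Y] [Module C Y] [Module Cᵐᵒᵖ Y] [IsScalarTower ℂ C Y]
  [IsBoundedSMul C Y] [IsCentralScalar C Y]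

variable {C X Y}

/-- The left multiplication `c (x ⊗ y) = cx ⊗ y`. -/
def leftMul (c : C) : ModTensor C X Y →L[ℂ] ModTensor C X Y :=
  modLift (modMk C X Y ∘L ptmap (smulL c) (.id ℂ Y)) fun x d y => by
    simp only [ContinuousLinearMap.comp_apply, ptmap_ptmul]
    rw [show smulL c (MulOpposite.op d • x) = MulOpposite.op d • c • x from smul_comm _ _ x]
    exact mtmul_balanced C (c • x) d y

/-- The right multiplication `(x ⊗ y) c = x ⊗ yc`. -/
def rightMul (c : Cᵐᵒᵖ) : ModTensor C X Y →L[ℂ] ModTensor C X Y :=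
  modLift (modMk C X Y ∘L ptmap (.id ℂ X) (smulL c)) fun x d y => by
    simp only [ContinuousLinearMap.comp_apply, ptmap_ptmul]
    rw [show smulL c (d • y) = d • c • y from smul_comm _ _ y]
    exact mtmul_balanced C x d (c • y)

theorem leftMul_mtmul (c : C) (x : X) (y : Y) :
    leftMul c (mtmul C x y) = mtmul C (c • x) y :=
  congrArg (modMk C X Y) (ptmap_ptmul _ _ x y)

theorem rightMul_mtmul (c : Cᵐᵒᵖ) (x : X) (y : Y) :
    rightMul c (mtmul C x y) = mtmul C x (c • y) :=
  congrArg (modMk C X Y) (ptmap_ptmul _ _ x y)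

theorem rightMul_op (c : C) : rightMul (X := X) (Y := Y) (MulOpposite.op c) = leftMul c :=
  modTensor_ext fun x y => by
    rw [rightMul_mtmul, leftMul_mtmul, op_smul_eq_smul, ← mtmul_balanced, op_smul_eq_smul]

theorem norm_leftMul_le (c : C) (z : ModTensor C X Y) : ‖leftMul c z‖ ≤ ‖c‖ * ‖z‖ := by
  refine norm_modLift_le _ _ (norm_nonneg c) (fun w => ?_) z
  refine (Submodule.Quotient.norm_mk_le (balancedKer C X Y) _).trans
    ((norm_ptmap_le _ _ w).trans (mul_le_mul_of_nonneg_right ?_ (norm_nonneg w)))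
  calc _ ≤ ‖c‖ * 1 := mul_le_mul (norm_smulL_le c) ContinuousLinearMap.norm_id_le
        (norm_nonneg _) (norm_nonneg _)
    _ = ‖c‖ := mul_one _

theorem mtmul_add_left (x x' : X) (y : Y) :
    mtmul C (x + x') y = mtmul C x y + mtmul C x' y := by
  simp [mtmul, add_ptmul]

theorem mtmul_smul_left (r : ℂ) (x : X) (y : Y) :
    mtmul C (r • x) y = r • mtmul C x y := by
  simp [mtmul, smul_ptmul]

/-- The left `C`-module structure, `c (x ⊗ y) = cx ⊗ y`. -/
instance : Module C (ModTensor C X Y) where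
  smul c z := leftMul c z
  one_smul z := DFunLike.congr_fun (f := leftMul (1 : C)) (g := .id ℂ _)
    (modTensor_ext fun x y => by simp [leftMul_mtmul]) z
  mul_smul c d z := DFunLike.congr_fun (f := leftMul (c * d)) (g := leftMul c ∘L leftMul d)
    (modTensor_ext fun x y => by simp [leftMul_mtmul, mul_smul]) z
  smul_zero c := map_zero (leftMul c)
  smul_add c := map_add (leftMul c)
  add_smul c d z := DFunLike.congr_fun (f := leftMul (c + d)) (g := leftMul c + leftMul d)
    (modTensor_ext fun x y => by simp [leftMul_mtmul, add_smul, mtmul_add_left]) z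
  zero_smul z := DFunLike.congr_fun (f := leftMul (0 : C)) (g := 0)
    (modTensor_ext fun x y => by
      rw [leftMul_mtmul, zero_smul, ← zero_smul ℂ (0 : X), mtmul_smul_left, zero_smul]; rfl) z

theorem smul_def (c : C) (z : ModTensor C X Y) : c • z = leftMul c z := rfl

/-- The right `C`-module structure, `(x ⊗ y) c = x ⊗ yc`. -/
instance : Module Cᵐᵒᵖ (ModTensor C X Y) where
  smul c z := rightMul c z
  one_smul z := by
    change rightMul (MulOpposite.op 1) z = z
    rw [rightMul_op, ← smul_def, one_smul]
  mul_smul c d z := by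
    change rightMul (MulOpposite.op (d.unop * c.unop)) z =
      rightMul (MulOpposite.op c.unop) (rightMul (MulOpposite.op d.unop) z)
    simp only [rightMul_op, ← smul_def]
    rw [mul_comm, mul_smul]
  smul_zero c := map_zero (rightMul c)
  smul_add c := map_add (rightMul c)
  add_smul c d z := by
    change rightMul (MulOpposite.op (c.unop + d.unop)) z =
      rightMul (MulOpposite.op c.unop) z + rightMul (MulOpposite.op d.unop) z
    simp only [rightMul_op, ← smul_def]
    rw [add_smul]
  zero_smul z := by
    change rightMul (MulOpposite.op 0) z = 0
    rw [rightMul_op, ← smul_def, zero_smul]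

instance : IsCentralScalar C (ModTensor C X Y) :=
  ⟨fun c z => DFunLike.congr_fun (rightMul_op c) z⟩

instance : IsScalarTower ℂ C (ModTensor C X Y) :=
  ⟨fun r c z => DFunLike.congr_fun (f := leftMul (r • c)) (g := r • leftMul c)
    (modTensor_ext fun x y => by simp [leftMul_mtmul, mtmul_smul_left]) z⟩

instance : IsBoundedSMul C (ModTensor C X Y) := IsBoundedSMul.of_norm_smul_le norm_leftMul_le

theorem toFiber_op_smul (t : WeakDual.characterSpace ℂ C) (c : C) (x : X) :
    toFiber C t (MulOpposite.op c • x) = t c • toFiber C t x := by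
  rw [op_smul_eq_smul, toFiber_smul]

/-- The contraction `x ⊗_C y ↦ x(t) ⊗ y(t)` into the projective tensor product of the fibres. -/
def kappaAt (t : WeakDual.characterSpace ℂ C) :
    ModTensor C X Y →L[ℂ] ProjTensor (Fiber C X t) (Fiber C Y t) :=
  modLift (ptmap (toFiber C t) (toFiber C t)) fun x c y => by
    rw [ptmap_ptmul, ptmap_ptmul, toFiber_op_smul, toFiber_smul, smul_ptmul, ptmul_smul]

theorem norm_kappaAt_le (t : WeakDual.characterSpace ℂ C) (z : ModTensor C X Y) :
    ‖kappaAt t z‖ ≤ ‖z‖ := by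
  have h := norm_modLift_le (C := C) (ptmap (toFiber C (X := X) t) (toFiber C (X := Y) t))
    (fun x c y => by
      rw [ptmap_ptmul, ptmap_ptmul, toFiber_op_smul, toFiber_smul, smul_ptmul, ptmul_smul])
    zero_le_one (fun w => (norm_ptmap_le _ _ w).trans (mul_le_mul_of_nonneg_right
      (mul_le_one₀ (norm_toFiber_le C t) (norm_nonneg _) (norm_toFiber_le C t)) (norm_nonneg w))) z
  rwa [one_mul] at h

variable (C X Y)

/-- The natural contraction `κ` into the `ℓ^∞`-direct sum over the spectrum (all bounded families,
with the supremum norm), `κ (x ⊗_C y) = (x(t) ⊗ y(t))_t`. -/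
def kappa : ModTensor C X Y →L[ℂ]
    lp (fun t : WeakDual.characterSpace ℂ C => ProjTensor (Fiber C X t) (Fiber C Y t)) ∞ :=
  LinearMap.mkContinuous
    { toFun := fun z => ⟨fun t => kappaAt t z, memℓp_infty
        ⟨‖z‖, by rintro _ ⟨t, rfl⟩; exact norm_kappaAt_le t z⟩⟩
      map_add' := fun z z' => by ext t; exact map_add (kappaAt t) z z'
      map_smul' := fun r z => by ext t; exact map_smul (kappaAt t) r z }
    1 fun z => by
      rw [one_mul]
      exact lp.norm_le_of_forall_le (norm_nonneg z) fun t => norm_kappaAt_le t z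

theorem kappa_mtmul (x : X) (y : Y) (t : WeakDual.characterSpace ℂ C) :
    kappa C X Y (mtmul C x y) t = ptmul (toFiber C t x) (toFiber C t y) :=
  ptmap_ptmul _ _ x y

end Bimodule

end CentralBimodule

end

/-!
In a representable bimodule `c₁* a c₁ + c₂* b c₂` is a contraction if `a`, `b` are and
`c₁* c₁ + c₂* c₂ = 1`. For central bimodules, applied to `X` and to `Y`, the identity
`2 (c² x ⊗ y + d² x' ⊗ y') = (c x + d x') ⊗ (c y + d y') + (c x - d x') ⊗ (c y - d y')` and
Hahn-Banach show that `c² z + (1 - c)² z'` lies in the unit ball of `X ⊗_C Y` whenever `0 ≤ c ≤ 1`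
and `z`, `z'` lie in it. Cutting `n c` into `n` successive ramps and adding up gives
`c z + (1 - c) z'` up to `O(1 / n)`. Hence `‖c · θ‖ + ‖(1 - c) · θ‖ ≤ ‖θ‖` for every functional `θ`,
so an extreme point `θ` of the dual ball satisfies `c · θ = t(c) θ` for a character `t`. Such
functionals norm `X ⊗_C Y`, and each of them factors through `X(t) ⊗ Y(t)`.
-/

namespace CentralBimodule

noncomputable section

section Contractions

open scoped InnerProduct InnerProductSpace

variable {𝕜 ι H H' K K' : Type*} [RCLike 𝕜] [Fintype ι]
  [NormedAddCommGroup H] [InnerProductSpace 𝕜 H] [CompleteSpace H]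
  [NormedAddCommGroup H'] [InnerProductSpace 𝕜 H'] [CompleteSpace H']
  [NormedAddCommGroup K] [InnerProductSpace 𝕜 K] [CompleteSpace K]
  [NormedAddCommGroup K'] [InnerProductSpace 𝕜 K'] [CompleteSpace K']

theorem sum_norm_sq_apply_of_sum_adjoint_comp_eq_id {T : ι → H →L[𝕜] H'}
    (hT : ∑ i, (T i)† ∘L T i = .id 𝕜 H) (x : H) : ∑ i, ‖T i x‖ ^ 2 = ‖x‖ ^ 2 := by
  simp_rw [ContinuousLinearMap.apply_norm_sq_eq_inner_adjoint_left, ← map_sum, ← sum_inner,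
    ← sum_apply, hT]
  exact inner_self_eq_norm_sq x

theorem norm_sum_adjoint_comp_comp_le_one {R : ι → H →L[𝕜] H'} {T : ι → K →L[𝕜] K'}
    (hR : ∑ i, (R i)† ∘L R i = .id 𝕜 H) (hT : ∑ i, (T i)† ∘L T i = .id 𝕜 K)
    {S : ι → K' →L[𝕜] H'} (hS : ∀ i, ‖S i‖ ≤ 1) :
    ‖∑ i, (R i)† ∘L S i ∘L T i‖ ≤ 1 := by
  refine ContinuousLinearMap.opNorm_le_of_re_inner_le zero_le_one fun x y hx hy => ?_
  calc RCLike.re ⟪(∑ i, (R i)† ∘L S i ∘L T i) x, y⟫_𝕜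
      = ∑ i, RCLike.re ⟪S i (T i x), R i y⟫_𝕜 := by
        simp [sum_apply, sum_inner, ContinuousLinearMap.adjoint_inner_left]
    _ ≤ ∑ i, ‖T i x‖ * ‖R i y‖ := Finset.sum_le_sum fun i _ =>
        (re_inner_le_norm _ _).trans <| mul_le_mul_of_nonneg_right
          ((S i).le_of_opNorm_le (hS i) (T i x) |>.trans_eq (one_mul _)) (norm_nonneg _)
    _ ≤ √(∑ i, ‖T i x‖ ^ 2) * √(∑ i, ‖R i y‖ ^ 2) := Real.sum_mul_le_sqrt_mul_sqrt _ _ _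
    _ = 1 := by
        rw [sum_norm_sq_apply_of_sum_adjoint_comp_eq_id hT,
          sum_norm_sq_apply_of_sum_adjoint_comp_eq_id hR, hx, hy, one_pow, Real.sqrt_one, one_mul]

end Contractions

section BallConvex

theorem IsRepresentable.norm_sum_star_smul_op_smul_le_one {A B X ι : Type*} [CStarAlgebra A]
    [CStarAlgebra B] [NormedAddCommGroup X] [NormedSpace ℂ X] [Module A X] [Module Bᵐᵒᵖ X]
    [Fintype ι] (hX : IsRepresentable A B X) {a : ι → A} {b : ι → B} {x : ι → X}
    (ha : ∑ i, star (a i) * a i = 1) (hb : ∑ i, star (b i) * b i = 1) (hx : ∀ i, ‖x i‖ ≤ 1) :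
    ‖∑ i, star (a i) • MulOpposite.op (b i) • x i‖ ≤ 1 := by
  obtain ⟨H, _, _, _, K, _, _, _, π, σ, Φ, hπ, hσ⟩ := hX
  have hπa : ∑ i, star (π (a i)) * π (a i) = 1 := by
    simpa only [map_sum, map_mul, map_star, map_one] using congrArg π ha
  have hσb : ∑ i, star (σ (b i)) * σ (b i) = 1 := by
    simpa only [map_sum, map_mul, map_star, map_one] using congrArg σ hb
  rw [← Φ.norm_map, map_sum]
  simp only [hπ, hσ, map_star]
  exact norm_sum_adjoint_comp_comp_le_one hπa hσb fun i => (Φ.norm_map (x i)).trans_le (hx i)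

/-- The unit ball of the `C`-module `Z` is convex with respect to coefficients from `C`: the
abstract property of central representable modules that characterizes them. -/
def IsBallConvex (C Z : Type*) [Ring C] [PartialOrder C] [SeminormedAddCommGroup Z]
    [Module C Z] : Prop :=
  ∀ c : C, 0 ≤ c → c ≤ 1 → ∀ x y : Z, ‖x‖ ≤ 1 → ‖y‖ ≤ 1 → ‖c • x + (1 - c) • y‖ ≤ 1

theorem IsRepresentable.isBallConvex {C X : Type*} [CommCStarAlgebra C] [PartialOrder C]
    [StarOrderedRing C] [NormedAddCommGroup X] [NormedSpace ℂ X] [Module C X] [Module Cᵐᵒᵖ X]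
    [IsCentralScalar C X] (hX : IsRepresentable C C X) : IsBallConvex C X := by
  intro c hc0 hc1 x y hx hy
  have star_sqrt_mul_sqrt (d : C) (hd : 0 ≤ d) : star (CFC.sqrt d) * CFC.sqrt d = d := by
    rw [(CFC.sqrt_nonneg d).isSelfAdjoint.star_eq, CFC.sqrt_mul_sqrt_self d hd]
  have hc := star_sqrt_mul_sqrt c hc0
  have hd := star_sqrt_mul_sqrt (1 - c) (sub_nonneg.2 hc1)
  have hsum : ∑ i, star (![CFC.sqrt c, CFC.sqrt (1 - c)] i) * ![CFC.sqrt c, CFC.sqrt (1 - c)] i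
      = 1 := by
    simp [hc, hd]
  simpa [Fin.sum_univ_two, op_smul_eq_smul, smul_smul, hc, hd] using
    hX.norm_sum_star_smul_op_smul_le_one hsum hsum (x := ![x, y])
      (Fin.forall_fin_two.2 ⟨hx, hy⟩)

end BallConvex

section ProjectiveUniversalProperty

variable {X Y E : Type*} [SeminormedAddCommGroup X] [NormedSpace ℂ X]
  [SeminormedAddCommGroup Y] [NormedSpace ℂ Y] [NormedAddCommGroup E] [NormedSpace ℂ E]

theorem norm_ptmul_le (x : X) (y : Y) : ‖ptmul x y‖ ≤ ‖x‖ * ‖y‖ :=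
  (UniformSpace.Completion.norm_coe _).trans_le (projNorm_le (projCosts_tmul x y))

theorem norm_le_mul_projNorm {f : X ⊗[ℂ] Y →ₗ[ℂ] E} {M : ℝ} (hM : 0 ≤ M)
    (hf : ∀ x y, ‖f (x ⊗ₜ y)‖ ≤ M * ‖x‖ * ‖y‖) (w : X ⊗[ℂ] Y) : ‖f w‖ ≤ M * projNorm w := by
  rw [projNorm, ← smul_eq_mul, ← Real.sInf_smul_of_nonneg hM]
  refine le_csInf (projCosts_nonempty w).smul_set ?_
  rintro _ ⟨_, ⟨n, x, y, rfl, rfl⟩, rfl⟩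
  simp only [map_sum, smul_eq_mul, Finset.mul_sum, ← mul_assoc]
  exact norm_sum_le_of_le _ fun i _ => hf (x i) (y i)

theorem opNorm_le_of_norm_ptmul_le {f : ProjTensor X Y →L[ℂ] E} {M : ℝ} (hM : 0 ≤ M)
    (hf : ∀ x y, ‖f (ptmul x y)‖ ≤ M * ‖x‖ * ‖y‖) : ‖f‖ ≤ M := by
  refine f.opNorm_le_bound hM fun w => ?_
  induction w using UniformSpace.Completion.induction_on with
  | hp => exact isClosed_le (by fun_prop) (by fun_prop)
  | ih w =>
    rw [UniformSpace.Completion.norm_coe]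
    exact norm_le_mul_projNorm
      (f := (f ∘L UniformSpace.Completion.toComplL (E := AlgTensor X Y)).toLinearMap) hM hf w

/-- The linear map on the projective tensor product induced by a bilinear map `B` with
`‖B x y‖ ≤ M * ‖x‖ * ‖y‖`: the extension to the completion of the algebraic lift of `B`. -/
def ptlift [CompleteSpace E] (B : X →ₗ[ℂ] Y →ₗ[ℂ] E) {M : ℝ} (hM : 0 ≤ M)
    (hB : ∀ x y, ‖B x y‖ ≤ M * ‖x‖ * ‖y‖) : ProjTensor X Y →L[ℂ] E :=
  let B' : AlgTensor X Y →L[ℂ] E :=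
    LinearMap.mkContinuous (TensorProduct.lift B : X ⊗[ℂ] Y →ₗ[ℂ] E) M (norm_le_mul_projNorm hM hB)
  B'.extend (UniformSpace.Completion.toComplL (E := AlgTensor X Y))

theorem ptlift_ptmul [CompleteSpace E] (B : X →ₗ[ℂ] Y →ₗ[ℂ] E) {M : ℝ} (hM : 0 ≤ M)
    (hB : ∀ x y, ‖B x y‖ ≤ M * ‖x‖ * ‖y‖) (x : X) (y : Y) :
    ptlift B hM hB (ptmul x y) = B x y :=
  ContinuousLinearMap.extend_eq _ UniformSpace.Completion.denseRange_coe
    (UniformSpace.Completion.isUniformInducing_coe _) _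

theorem norm_ptlift_le [CompleteSpace E] (B : X →ₗ[ℂ] Y →ₗ[ℂ] E) {M : ℝ} (hM : 0 ≤ M)
    (hB : ∀ x y, ‖B x y‖ ≤ M * ‖x‖ * ‖y‖) : ‖ptlift B hM hB‖ ≤ M :=
  opNorm_le_of_norm_ptmul_le hM fun x y => by
    rw [ptlift_ptmul]
    exact hB x y

end ProjectiveUniversalProperty

section Quotient

theorem opNorm_le_opNorm_comp_mkQL {𝕜 V E : Type*} [NontriviallyNormedField 𝕜]
    [SeminormedAddCommGroup V] [NormedSpace 𝕜 V] [SeminormedAddCommGroup E] [NormedSpace 𝕜 E]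
    {S : Submodule 𝕜 V} (f : V ⧸ S →L[𝕜] E) : ‖f‖ ≤ ‖f ∘L S.mkQL‖ := by
  refine f.opNorm_le_bound (norm_nonneg _) fun q => ?_
  refine le_mul_of_forall_lt₀ fun M hM r hr => ?_
  obtain ⟨v, rfl, hv⟩ := QuotientAddGroup.norm_lt_iff.1 hr
  exact ((f ∘L S.mkQL).le_opNorm v).trans
    (mul_le_mul hM.le hv.le (norm_nonneg v) ((norm_nonneg _).trans hM.le))

end Quotient

section ModTensorNorm

variable {C X Y E : Type*} [CommCStarAlgebra C]
  [NormedAddCommGroup X] [NormedSpace ℂ X] [Module Cᵐᵒᵖ X]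
  [NormedAddCommGroup Y] [NormedSpace ℂ Y] [Module C Y]
  [NormedAddCommGroup E] [NormedSpace ℂ E]

theorem mtmul_add (x : X) (y y' : Y) : mtmul C x (y + y') = mtmul C x y + mtmul C x y' := by
  simp only [mtmul, ptmul_add, map_add]

theorem mtmul_smul (r : ℂ) (x : X) (y : Y) : mtmul C x (r • y) = r • mtmul C x y := by
  simp only [mtmul, ptmul_smul, map_smul]

theorem norm_mtmul_le (x : X) (y : Y) : ‖mtmul C x y‖ ≤ ‖x‖ * ‖y‖ :=
  (Submodule.Quotient.norm_mk_le (balancedKer C X Y) _).trans (norm_ptmul_le x y)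

/-- The bounded bilinear map `(x, y) ↦ f (x ⊗_C y)` corresponding to `f`. -/
def toBilin (f : ModTensor C X Y →L[ℂ] E) : X →L[ℂ] Y →L[ℂ] E :=
  LinearMap.mkContinuous₂
    (LinearMap.mk₂ ℂ (fun x y => f (mtmul C x y))
      (fun x x' y => by simp only [mtmul, add_ptmul, map_add])
      (fun r x y => by simp only [mtmul, smul_ptmul, map_smul])
      (fun x y y' => by simp only [mtmul_add, map_add])
      (fun r x y => by simp only [mtmul_smul, map_smul]))
    ‖f‖ fun x y => (f.le_opNorm_of_le (norm_mtmul_le x y)).trans_eq (mul_assoc _ _ _).symm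

theorem toBilin_apply (f : ModTensor C X Y →L[ℂ] E) (x : X) (y : Y) :
    toBilin f x y = f (mtmul C x y) := rfl

theorem norm_toBilin (f : ModTensor C X Y →L[ℂ] E) : ‖toBilin f‖ = ‖f‖ :=
  le_antisymm (LinearMap.mkContinuous₂_norm_le _ (norm_nonneg f) _)
    ((opNorm_le_opNorm_comp_mkQL f).trans
      (opNorm_le_of_norm_ptmul_le (norm_nonneg (toBilin f)) (toBilin f).le_opNorm₂))

theorem opNorm_le_of_norm_mtmul_le {f : ModTensor C X Y →L[ℂ] E} {M : ℝ} (hM : 0 ≤ M)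
    (hf : ∀ x y, ‖x‖ ≤ 1 → ‖y‖ ≤ 1 → ‖f (mtmul C x y)‖ ≤ M) : ‖f‖ ≤ M := by
  rw [← norm_toBilin]
  exact ContinuousLinearMap.opNorm_le_of_unit_norm hM fun x hx =>
    ContinuousLinearMap.opNorm_le_of_unit_norm hM fun y hy => hf x y hx.le hy.le

end ModTensorNorm

section ClosedConvexHull

open Metric

theorem closedBall_subset_closedConvexHull {𝕜 E : Type*} [RCLike 𝕜] [SeminormedAddCommGroup E]
    [NormedSpace 𝕜 E] [NormedSpace ℝ E] [IsScalarTower ℝ 𝕜 E] {s : Set E}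
    (hs : ∀ u : 𝕜, ‖u‖ = 1 → ∀ x ∈ s, u • x ∈ s)
    (hnorm : ∀ (f : StrongDual 𝕜 E) (M : ℝ), (∀ x ∈ s, ‖f x‖ ≤ M) → ‖f‖ ≤ M) :
    closedBall 0 1 ⊆ closedConvexHull ℝ s := by
  intro x hx
  by_contra hxs
  obtain ⟨f, M, hfM, hMx⟩ := RCLike.geometric_hahn_banach_closed_point (𝕜 := 𝕜)
    convex_closedConvexHull isClosed_closedConvexHull hxs
  have norm_le_of_mem (y : E) (hy : y ∈ s) : ‖f y‖ ≤ M := by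
    obtain ⟨u, hu, hfu⟩ := RCLike.exists_norm_eq_mul_self (f y)
    have h := hfM _ (subset_closedConvexHull (hs u hu y hy))
    rw [map_smul, smul_eq_mul, ← hfu, RCLike.ofReal_re] at h
    exact h.le
  have hfx : ‖f x‖ ≤ M :=
    (f.unit_le_opNorm x (mem_closedBall_zero_iff.1 hx)).trans (hnorm f M norm_le_of_mem)
  exact hMx.not_ge ((RCLike.re_le_norm _).trans hfx)

theorem norm_map_add_map_le_of_mem_closedConvexHull {E E' F : Type*} [SeminormedAddCommGroup E]
    [NormedSpace ℝ E] [SeminormedAddCommGroup E'] [NormedSpace ℝ E'] [SeminormedAddCommGroup F]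
    [NormedSpace ℝ F] (f : E →L[ℝ] F) (g : E' →L[ℝ] F) {s : Set E} {t : Set E'} {M : ℝ}
    (h : ∀ x ∈ s, ∀ y ∈ t, ‖f x + g y‖ ≤ M) {x : E} {y : E'}
    (hx : x ∈ closedConvexHull ℝ s) (hy : y ∈ closedConvexHull ℝ t) : ‖f x + g y‖ ≤ M := by
  have hull_subset : closedConvexHull ℝ (s ×ˢ t) ⊆ f.coprod g ⁻¹' closedBall 0 M := by
    refine closedConvexHull_min (fun p hp => ?_)
      ((convex_closedBall 0 M).linear_preimage (f.coprod g).toLinearMap)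
      (isClosed_closedBall.preimage (f.coprod g).continuous)
    simpa using h p.1 hp.1 p.2 hp.2
  have hxy : (x, y) ∈ closedConvexHull ℝ (s ×ˢ t) := by
    rw [closedConvexHull_eq_closure_convexHull] at hx hy ⊢
    rw [convexHull_prod, closure_prod_eq]
    exact ⟨hx, hy⟩
  simpa using hull_subset hxy

end ClosedConvexHull

section SquareConvexity

theorem map₂_add_add_add_map₂_sub_sub {𝕜 X Y E : Type*} [NontriviallyNormedField 𝕜]
    [SeminormedAddCommGroup X] [NormedSpace 𝕜 X] [SeminormedAddCommGroup Y] [NormedSpace 𝕜 Y]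
    [SeminormedAddCommGroup E] [NormedSpace 𝕜 E] (B : X →L[𝕜] Y →L[𝕜] E) (x x' : X) (y y' : Y) :
    B (x + x') (y + y') + B (x - x') (y - y') = (2 : 𝕜) • (B x y + B x' y') := by
  simp only [map_add, map_sub, add_apply, sub_apply]
  module

variable {C X Y : Type*} [CommCStarAlgebra C]
  [NormedAddCommGroup X] [NormedSpace ℂ X] [Module C X] [Module Cᵐᵒᵖ X] [IsScalarTower ℂ C X]
  [IsBoundedSMul C X] [IsCentralScalar C X]
  [NormedAddCommGroup Y] [NormedSpace ℂ Y] [Module C Y] [Module Cᵐᵒᵖ Y] [IsScalarTower ℂ C Y]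
  [IsBoundedSMul C Y] [IsCentralScalar C Y]

theorem mtmul_smul_smul (c d : C) (x : X) (y : Y) :
    mtmul C (c • x) (d • y) = (c * d) • mtmul C x y := by
  rw [← mtmul_balanced, op_smul_eq_smul, smul_smul, mul_comm, smul_def, leftMul_mtmul]

theorem closedBall_subset_closedConvexHull_mtmul :
    Metric.closedBall (0 : ModTensor C X Y) 1 ⊆
      closedConvexHull ℝ {z | ∃ x y, ‖x‖ ≤ 1 ∧ ‖y‖ ≤ 1 ∧ z = mtmul C x y} := by
  refine closedBall_subset_closedConvexHull (𝕜 := ℂ) ?_ fun f M hM => ?_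
  · rintro u hu _ ⟨x, y, hx, hy, rfl⟩
    exact ⟨u • x, y, by rwa [norm_smul, hu, one_mul], hy, (mtmul_smul_left u x y).symm⟩
  · have hM' (x : X) (y : Y) (hx : ‖x‖ ≤ 1) (hy : ‖y‖ ≤ 1) : ‖f (mtmul C x y)‖ ≤ M :=
      hM _ ⟨x, y, hx, hy, rfl⟩
    exact opNorm_le_of_norm_mtmul_le
      ((norm_nonneg _).trans (hM' 0 0 (by simp) (by simp))) hM'

variable [PartialOrder C]

theorem IsBallConvex.norm_sub_le_one {Z : Type*} [SeminormedAddCommGroup Z] [Module C Z]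
    (hZ : IsBallConvex C Z) {c : C} (hc0 : 0 ≤ c) (hc1 : c ≤ 1) {x y : Z}
    (hx : ‖x‖ ≤ 1) (hy : ‖y‖ ≤ 1) : ‖c • x - (1 - c) • y‖ ≤ 1 := by
  rw [sub_eq_add_neg, ← smul_neg]
  exact hZ c hc0 hc1 x (-y) hx ((norm_neg y).trans_le hy)

theorem norm_sq_smul_mtmul_add_sq_smul_mtmul_le_one (hX : IsBallConvex C X)
    (hY : IsBallConvex C Y) {c : C} (hc0 : 0 ≤ c) (hc1 : c ≤ 1) {x x' : X} {y y' : Y}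
    (hx : ‖x‖ ≤ 1) (hx' : ‖x'‖ ≤ 1) (hy : ‖y‖ ≤ 1) (hy' : ‖y'‖ ≤ 1) :
    ‖c ^ 2 • mtmul C x y + (1 - c) ^ 2 • mtmul C x' y'‖ ≤ 1 := by
  have hsum := map₂_add_add_add_map₂_sub_sub (toBilin (.id ℂ (ModTensor C X Y)))
    (c • x) ((1 - c) • x') (c • y) ((1 - c) • y')
  simp only [toBilin_apply, ContinuousLinearMap.id_apply, mtmul_smul_smul, ← sq] at hsum
  have norm_mtmul_le_one {u : X} {v : Y} (hu : ‖u‖ ≤ 1) (hv : ‖v‖ ≤ 1) : ‖mtmul C u v‖ ≤ 1 :=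
    (norm_mtmul_le u v).trans (mul_le_one₀ hu (norm_nonneg v) hv)
  have hplus := norm_mtmul_le_one (hX c hc0 hc1 x x' hx hx') (hY c hc0 hc1 y y' hy hy')
  have hminus := norm_mtmul_le_one (hX.norm_sub_le_one hc0 hc1 hx hx')
    (hY.norm_sub_le_one hc0 hc1 hy hy')
  have htwo := (norm_add_le _ _).trans (add_le_add hplus hminus)
  rw [hsum, norm_smul, Complex.norm_ofNat] at htwo
  linarith

theorem norm_sq_smul_add_sq_smul_le_one (hX : IsBallConvex C X) (hY : IsBallConvex C Y)
    {c : C} (hc0 : 0 ≤ c) (hc1 : c ≤ 1) {z z' : ModTensor C X Y}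
    (hz : ‖z‖ ≤ 1) (hz' : ‖z'‖ ≤ 1) : ‖c ^ 2 • z + (1 - c) ^ 2 • z'‖ ≤ 1 := by
  refine norm_map_add_map_le_of_mem_closedConvexHull ((smulL (c ^ 2)).restrictScalars ℝ)
    ((smulL ((1 - c) ^ 2)).restrictScalars ℝ) ?_
    (closedBall_subset_closedConvexHull_mtmul (mem_closedBall_zero_iff.2 hz))
    (closedBall_subset_closedConvexHull_mtmul (mem_closedBall_zero_iff.2 hz'))
  rintro _ ⟨x, y, hx, hy, rfl⟩ _ ⟨x', y', hx', hy', rfl⟩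
  exact norm_sq_smul_mtmul_add_sq_smul_mtmul_le_one hX hY hc0 hc1 hx hx' hy hy'

end SquareConvexity

section Ramp

/-- The length of the part of `[0, u]` lying in the unit interval `[k, k + 1]`. The ramps cut the
function `u ↦ u` into functions with values in `[0, 1]`, of which at most one is fractional at
any point. -/
def ramp (k : ℕ) (u : ℝ) : ℝ := min u (k + 1) - min u k

theorem ramp_nonneg (k : ℕ) (u : ℝ) : 0 ≤ ramp k u :=
  sub_nonneg.2 (min_le_min_left u (by simp))

theorem ramp_le_one (k : ℕ) (u : ℝ) : ramp k u ≤ 1 := by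
  unfold ramp
  grind

@[fun_prop]
theorem continuous_ramp (k : ℕ) : Continuous (ramp k) := by
  unfold ramp
  fun_prop

theorem sum_ramp {N : ℕ} {u : ℝ} (hu0 : 0 ≤ u) (huN : u ≤ N) :
    ∑ k ∈ Finset.range N, ramp k u = u := by
  have h := Finset.sum_range_sub (fun k : ℕ => min u k) N
  simpa [ramp, hu0, huN] using h

theorem ramp_succ_le_sq (k : ℕ) (u : ℝ) : ramp (k + 1) u ≤ ramp k u ^ 2 := by
  unfold ramp
  rcases le_total u (k + 1) with h | h
  · rw [min_eq_left (by push_cast; linarith), min_eq_left (by push_cast; linarith), sub_self]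
    positivity
  · rw [min_eq_right h]
    rw [min_eq_right (a := u) (b := k) (by linarith)]
    push_cast
    grind

theorem sum_ramp_mul_one_sub_ramp_le_one (N : ℕ) (u : ℝ) :
    ∑ k ∈ Finset.range N, ramp k u * (1 - ramp k u) ≤ 1 :=
  calc ∑ k ∈ Finset.range N, ramp k u * (1 - ramp k u)
      ≤ ∑ k ∈ Finset.range N, (ramp k u - ramp (k + 1) u) :=
        Finset.sum_le_sum fun k _ => by linarith [ramp_succ_le_sq k u]
    _ = ramp 0 u - ramp N u := Finset.sum_range_sub' (fun k => ramp k u) N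
    _ ≤ 1 := by linarith [ramp_nonneg N u, ramp_le_one 0 u]

end Ramp

section OfSq

theorem exists_sum_eq_norm_sum_mul_one_sub_le_one {A : Type*} [CStarAlgebra A] [PartialOrder A]
    [StarOrderedRing A] {d : A} {N : ℕ} (hd0 : 0 ≤ d) (hdN : d ≤ N) :
    ∃ a : ℕ → A, (∀ k, 0 ≤ a k ∧ a k ≤ 1) ∧ ∑ k ∈ Finset.range N, a k = d ∧
      ‖∑ k ∈ Finset.range N, a k * (1 - a k)‖ ≤ 1 := by
  have hd : IsSelfAdjoint d := hd0.isSelfAdjoint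
  refine ⟨fun k => cfc (ramp k) d, fun k =>
    ⟨cfc_nonneg fun u _ => ramp_nonneg k u, cfc_le_one _ _ fun u _ => ramp_le_one k u⟩, ?_, ?_⟩
  · have sum_ramp_eq (u : ℝ) (hu : u ∈ spectrum ℝ d) : ∑ k ∈ Finset.range N, ramp k u = u :=
      sum_ramp (spectrum_nonneg_of_nonneg hd0 hu)
        ((le_algebraMap_iff_spectrum_le (r := (N : ℝ))).1 (by simpa using hdN) u hu)
    rw [← cfc_sum (fun k => ramp k) d _ fun k _ => (continuous_ramp k).continuousOn,
      Finset.sum_fn, cfc_congr sum_ramp_eq, cfc_id' ℝ d]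
  · have cfc_mul_one_sub (k : ℕ) : cfc (ramp k) d * (1 - cfc (ramp k) d) =
        cfc (fun u => ramp k u * (1 - ramp k u)) d := by
      rw [cfc_mul .., cfc_sub .., cfc_const_one ℝ d]
    simp only [cfc_mul_one_sub]
    rw [← cfc_sum _ d _ fun k _ => by fun_prop]
    refine norm_cfc_le zero_le_one fun u _ => ?_
    rw [Finset.sum_apply, Real.norm_of_nonneg (Finset.sum_nonneg fun k _ =>
      mul_nonneg (ramp_nonneg k u) (sub_nonneg.2 (ramp_le_one k u)))]
    exact sum_ramp_mul_one_sub_ramp_le_one N u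

theorem isBallConvex_of_sq {C Z : Type*} [CommCStarAlgebra C] [PartialOrder C] [StarOrderedRing C]
    [NormedAddCommGroup Z] [NormedSpace ℂ Z] [Module C Z] [IsBoundedSMul C Z]
    (hZ : ∀ c : C, 0 ≤ c → c ≤ 1 → ∀ x y : Z, ‖x‖ ≤ 1 → ‖y‖ ≤ 1 →
      ‖c ^ 2 • x + (1 - c) ^ 2 • y‖ ≤ 1) : IsBallConvex C Z := by
  intro c hc0 hc1 x y hx hy
  have nsmul_bound (N : ℕ) : N * ‖c • x + (1 - c) • y‖ ≤ N + 2 := by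
    obtain ⟨a, ha, hsum, herr⟩ := exists_sum_eq_norm_sum_mul_one_sub_le_one
      (d := N • c) (N := N) (nsmul_nonneg hc0 N) (by simpa using nsmul_le_nsmul_right hc1 N)
    set e := ∑ k ∈ Finset.range N, a k * (1 - a k) with he
    have hdecomp : N • (c • x + (1 - c) • y) =
        ∑ k ∈ Finset.range N, (a k ^ 2 • x + (1 - a k) ^ 2 • y) + e • (x + y) := by
      have hsum' : ∑ k ∈ Finset.range N, (1 - a k) = N • (1 - c) := by
        rw [Finset.sum_sub_distrib, hsum, Finset.sum_const, Finset.card_range, nsmul_sub]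
      rw [smul_add, ← smul_assoc, ← smul_assoc, ← hsum, ← hsum', he, Finset.sum_smul,
        Finset.sum_smul, Finset.sum_smul, ← Finset.sum_add_distrib, ← Finset.sum_add_distrib]
      exact Finset.sum_congr rfl fun k _ => by module
    have hsq : ‖∑ k ∈ Finset.range N, (a k ^ 2 • x + (1 - a k) ^ 2 • y)‖ ≤ N := by
      simpa using norm_sum_le_of_le (Finset.range N) fun k _ => hZ (a k) (ha k).1 (ha k).2 x y hx hy
    have herr' : ‖e • (x + y)‖ ≤ 1 * (1 + 1) :=
      (norm_smul_le _ _).trans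
        (mul_le_mul herr (norm_add_le_of_le hx hy) (norm_nonneg _) zero_le_one)
    rw [← nsmul_eq_mul, ← RCLike.norm_nsmul ℂ, hdecomp]
    linarith [norm_add_le_of_le hsq herr']
  by_contra! hgt
  obtain ⟨N, hN⟩ := exists_lt_nsmul (sub_pos.2 hgt) 2
  rw [nsmul_eq_mul] at hN
  linarith [nsmul_bound N]

end OfSq

section ExtremePoints

theorem exists_mem_extremePoints_forall_le {E : Type*} [AddCommGroup E] [Module ℝ E]
    [TopologicalSpace E] [IsTopologicalAddGroup E] [ContinuousSMul ℝ E] [LocallyConvexSpace ℝ E]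
    [T2Space E] {K : Set E} (hK : IsCompact K) (hne : K.Nonempty) (l : StrongDual ℝ E) :
    ∃ x ∈ K.extremePoints ℝ, ∀ y ∈ K, l y ≤ l x := by
  have hexp : IsExposed ℝ K (l.toExposed K) := ContinuousLinearMap.toExposed.isExposed
  obtain ⟨x₀, hx₀, hmax⟩ := hK.exists_isMaxOn hne l.continuous.continuousOn
  obtain ⟨x, hx⟩ := (hexp.isCompact hK).extremePoints_nonempty ⟨x₀, hx₀, hmax⟩
  exact ⟨x, hexp.isExtreme.extremePoints_subset_extremePoints hx, hx.1.2⟩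

theorem exists_mem_extremePoints_closedBall_apply_eq_norm {𝕜 E : Type*} [RCLike 𝕜]
    [NormedAddCommGroup E] [NormedSpace 𝕜 E] (x : E) :
    ∃ θ ∈ (Metric.closedBall (0 : StrongDual 𝕜 E) 1).extremePoints ℝ, θ x = ‖x‖ := by
  have : LocallyConvexSpace ℝ (WeakDual 𝕜 E) := (WeakDual.withSeminorms 𝕜 E).toLocallyConvexSpace
  let reEval : WeakDual 𝕜 E →L[ℝ] ℝ :=
    { toFun := fun θ => RCLike.re (θ x)
      map_add' := fun θ θ' => map_add RCLike.re (θ x) (θ' x)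
      map_smul' := fun r θ => RCLike.smul_re r (θ x)
      cont := RCLike.continuous_re.comp (WeakDual.eval_continuous x) }
  obtain ⟨θ, hθ, hmax⟩ := exists_mem_extremePoints_forall_le
    (WeakDual.isCompact_closedBall (0 : StrongDual 𝕜 E) 1) ⟨0, by simp⟩ reEval
  refine ⟨WeakDual.toStrongDual θ, hθ, ?_⟩
  have hθ1 : ‖WeakDual.toStrongDual θ‖ ≤ 1 := mem_closedBall_zero_iff.1 hθ.1
  obtain ⟨η, hη1, hηx⟩ := exists_dual_vector'' 𝕜 x
  have hre : ‖x‖ ≤ RCLike.re (θ x) :=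
    calc ‖x‖ = RCLike.re (η x) := by rw [hηx, RCLike.ofReal_re]
      _ ≤ RCLike.re (θ x) := hmax (StrongDual.toWeakDual η) (mem_closedBall_zero_iff.2 hη1)
  have hnorm : ‖θ x‖ = ‖x‖ :=
    le_antisymm (((WeakDual.toStrongDual θ).le_of_opNorm_le hθ1 x).trans_eq (one_mul _))
      (hre.trans (RCLike.re_le_norm _))
  rw [← hnorm]
  exact RCLike.norm_le_re_iff_eq_norm.1 (hnorm.trans_le hre)

theorem eq_norm_smul_of_add_mem_extremePoints_closedBall {E : Type*} [NormedAddCommGroup E]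
    [NormedSpace ℝ E] {y z : E} (hyz : y + z ∈ (Metric.closedBall (0 : E) 1).extremePoints ℝ)
    (hnorm : ‖y‖ + ‖z‖ ≤ 1) : y = ‖y‖ • (y + z) := by
  rcases eq_or_ne y 0 with rfl | hy
  · simp
  rcases eq_or_ne z 0 with rfl | hz
  · have : Nontrivial E := ⟨y, 0, hy⟩
    have hy1 : ‖y + 0‖ = 1 :=
      mem_sphere_zero_iff_norm.1 (extremePoints_closedBall_subset_sphere hyz)
    rw [add_zero] at hy1 ⊢
    rw [hy1, one_smul]
  have hy0 := norm_pos_iff.2 hy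
  have hz0 := norm_pos_iff.2 hz
  have hy1 : 0 < 1 - ‖y‖ := by linarith
  have hseg : y + z ∈ openSegment ℝ (‖y‖⁻¹ • y) ((1 - ‖y‖)⁻¹ • z) :=
    ⟨‖y‖, 1 - ‖y‖, hy0, hy1, by ring, by rw [smul_inv_smul₀ hy0.ne', smul_inv_smul₀ hy1.ne']⟩
  have hmem : ‖y‖⁻¹ • y ∈ Metric.closedBall (0 : E) 1 := by simp [norm_smul, hy]
  have hmem' : (1 - ‖y‖)⁻¹ • z ∈ Metric.closedBall (0 : E) 1 := by
    rw [mem_closedBall_zero_iff, norm_smul, Real.norm_of_nonneg (by positivity),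
      inv_mul_le_one₀ hy1]
    linarith
  rw [← (mem_extremePoints_iff_left.1 hyz).2 _ hmem _ hmem' hseg, smul_inv_smul₀ hy0.ne']

end ExtremePoints

section EquivariantFunctionals

theorem opNorm_add_opNorm_le {𝕜 E F : Type*} [RCLike 𝕜] [NormedAddCommGroup E] [NormedSpace 𝕜 E]
    [NormedAddCommGroup F] [NormedSpace 𝕜 F] {f : StrongDual 𝕜 E} {g : StrongDual 𝕜 F} {M : ℝ}
    (h : ∀ x y, ‖x‖ ≤ 1 → ‖y‖ ≤ 1 → ‖f x + g y‖ ≤ M) : ‖f‖ + ‖g‖ ≤ M := by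
  refine add_le_of_forall_lt fun a ha b hb => ?_
  obtain ⟨x, hx, hax⟩ := f.exists_lt_apply_of_lt_opNorm ha
  obtain ⟨y, hy, hby⟩ := g.exists_lt_apply_of_lt_opNorm hb
  obtain ⟨u, hu, hux⟩ := RCLike.exists_norm_eq_mul_self (f x)
  obtain ⟨v, hv, hvy⟩ := RCLike.exists_norm_eq_mul_self (g y)
  calc a + b ≤ ‖f x‖ + ‖g y‖ := add_le_add hax.le hby.le
    _ = ‖f (u • x) + g (v • y)‖ := by
      rw [map_smul, map_smul, smul_eq_mul, smul_eq_mul, ← hux, ← hvy, ← RCLike.ofReal_add,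
        RCLike.norm_of_nonneg (by positivity)]
    _ ≤ M := h _ _ (by rw [norm_smul, hu, one_mul]; exact hx.le)
      (by rw [norm_smul, hv, one_mul]; exact hy.le)

theorem exists_algHom_of_forall_exists_smul {𝕜 A Z : Type*} [Field 𝕜] [Ring A] [Algebra 𝕜 A]
    [AddCommGroup Z] [Module 𝕜 Z] [Module A Z] [IsScalarTower 𝕜 A Z] {f : Module.Dual 𝕜 Z}
    (hf : f ≠ 0) (h : ∀ a : A, ∃ r : 𝕜, ∀ z, f (a • z) = r * f z) :
    ∃ φ : A →ₐ[𝕜] 𝕜, ∀ (a : A) (z : Z), f (a • z) = φ a * f z := by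
  obtain ⟨z, hz⟩ : ∃ z, f z ≠ 0 := by simpa [LinearMap.ext_iff] using hf
  choose r hr using h
  have eq_of_mul_eq {s s' : 𝕜} (hs : s * f z = s' * f z) : s = s' := mul_right_cancel₀ hz hs
  let φ : A →ₗ[𝕜] 𝕜 :=
    { toFun := r
      map_add' := fun a b => eq_of_mul_eq <| by
        rw [← hr, add_smul, map_add, hr, hr, add_mul]
      map_smul' := fun s a => eq_of_mul_eq <| by
        rw [← hr, smul_assoc, map_smul, hr, RingHom.id_apply, smul_eq_mul, smul_eq_mul, mul_assoc] }
  exact ⟨AlgHom.ofLinearMap φ (eq_of_mul_eq <| (hr 1 z).symm.trans <| by rw [one_smul, one_mul])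
    fun a b => eq_of_mul_eq <| (hr (a * b) z).symm.trans <| by
      rw [mul_smul, hr, hr, mul_assoc]; rfl, hr⟩

variable {C Z : Type*} [CommCStarAlgebra C] [NormedAddCommGroup Z] [NormedSpace ℂ Z] [Module C Z]

/-- A bounded linear map is equivariant along the character `t` if it intertwines the action of
`C` with the action through `t`, that is, if it is a module map into `E` regarded as a `C`-module
concentrated at the point `t` of the spectrum. -/
def IsEquivariant {E : Type*} [NormedAddCommGroup E] [NormedSpace ℂ E]
    (t : WeakDual.characterSpace ℂ C) (f : Z →L[ℂ] E) : Prop :=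
  ∀ (c : C) (z : Z), f (c • z) = t c • f z

variable [IsScalarTower ℂ C Z] [PartialOrder C]

theorem exists_isEquivariant_of_forall_nonneg_le_one [StarOrderedRing C] {θ : StrongDual ℂ Z}
    (hθ : θ ≠ 0) (h : ∀ c : C, 0 ≤ c → c ≤ 1 → ∃ r : ℂ, ∀ z, θ (c • z) = r * θ z) :
    ∃ t : WeakDual.characterSpace ℂ C, IsEquivariant t θ := by
  have h' (c : C) : ∃ r : ℂ, ∀ z, θ (c • z) = r * θ z := by
    have hc : c ∈ Submodule.span ℂ ({x : C | 0 ≤ x} ∩ Metric.closedBall 0 1) :=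
      CStarAlgebra.span_nonneg_inter_unitClosedBall (A := C) ▸ Submodule.mem_top
    induction hc using Submodule.span_induction with
    | mem c hc =>
      exact h c hc.1 ((CStarAlgebra.norm_le_one_iff_of_nonneg c hc.1).1
        (mem_closedBall_zero_iff.1 hc.2))
    | zero => exact ⟨0, fun z => by simp⟩
    | add c d _ _ hc hd =>
      obtain ⟨r, hr⟩ := hc
      obtain ⟨s, hs⟩ := hd
      exact ⟨r + s, fun z => by rw [add_smul, map_add, hr, hs, add_mul]⟩
    | smul a c _ hc =>
      obtain ⟨r, hr⟩ := hc
      exact ⟨a * r, fun z => by rw [smul_assoc, map_smul, hr, smul_eq_mul, mul_assoc]⟩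
  obtain ⟨φ, hφ⟩ := exists_algHom_of_forall_exists_smul (f := θ.toLinearMap)
    (mt (fun h => ContinuousLinearMap.coe_injective h) hθ) h'
  exact ⟨WeakDual.CharacterSpace.equivAlgHom.symm φ, hφ⟩

variable [IsBoundedSMul C Z]

theorem IsBallConvex.norm_comp_smulL_add_norm_comp_smulL_le
    (hZ : IsBallConvex C Z) (θ : StrongDual ℂ Z) {c : C} (hc0 : 0 ≤ c) (hc1 : c ≤ 1) :
    ‖θ ∘L smulL c‖ + ‖θ ∘L smulL (1 - c)‖ ≤ ‖θ‖ := by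
  refine opNorm_add_opNorm_le fun x y hx hy => ?_
  rw [ContinuousLinearMap.comp_apply, ContinuousLinearMap.comp_apply, ← map_add]
  exact θ.le_opNorm_of_le (hZ c hc0 hc1 x y hx hy) |>.trans_eq (mul_one _)

theorem IsBallConvex.exists_isEquivariant_apply_eq_norm [StarOrderedRing C]
    (hZ : IsBallConvex C Z) {z : Z} (hz : z ≠ 0) :
    ∃ (t : WeakDual.characterSpace ℂ C) (θ : StrongDual ℂ Z),
      ‖θ‖ ≤ 1 ∧ IsEquivariant t θ ∧ θ z = ‖z‖ := by
  obtain ⟨θ, hθ, hθz⟩ := exists_mem_extremePoints_closedBall_apply_eq_norm (𝕜 := ℂ) z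
  have hθ0 : θ ≠ 0 := by
    rintro rfl
    exact hz (norm_eq_zero.1 (Complex.ofReal_eq_zero.1 hθz.symm))
  have hθ1 : ‖θ‖ ≤ 1 := mem_closedBall_zero_iff.1 hθ.1
  obtain ⟨t, ht⟩ := exists_isEquivariant_of_forall_nonneg_le_one (C := C) hθ0 fun c hc0 hc1 => by
    have hsum : θ ∘L smulL c + θ ∘L smulL (1 - c) = θ := by
      ext w
      change θ (c • w) + θ ((1 - c) • w) = θ w
      rw [← map_add, ← add_smul, add_sub_cancel, one_smul]
    have hscalar := eq_norm_smul_of_add_mem_extremePoints_closedBall (hsum.symm ▸ hθ)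
      ((hZ.norm_comp_smulL_add_norm_comp_smulL_le θ hc0 hc1).trans hθ1)
    rw [hsum] at hscalar
    exact ⟨_, fun w => congr($hscalar w)⟩
  exact ⟨t, θ, hθ1, ht, hθz⟩

end EquivariantFunctionals

section DiagonalRepresentation

variable {ι C Z : Type*} [CommCStarAlgebra C] [NormedAddCommGroup Z] [NormedSpace ℂ Z]

/-- The multiplication representation of `ℓ^∞(ι)` by diagonal operators on `ℓ²(ι)`. -/
def diagonal (ι : Type*) :
    lp (fun _ : ι => ℂ) ∞ →⋆ₐ[ℂ] (lp (fun _ : ι => ℂ) 2 →L[ℂ] lp (fun _ : ι => ℂ) 2) where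
  toFun g := lp.mapCLM 2 (fun i => g i • .id ℂ ℂ) (norm_nonneg g) fun i => by
    simpa [norm_smul] using lp.norm_apply_le_norm ENNReal.top_ne_zero g i
  map_one' := by ext f i; simp
  map_mul' g h := by ext f i; simp [mul_assoc]
  map_zero' := by ext f i; simp
  map_add' g h := by ext f i; simp [add_mul]
  commutes' r := by ext f i; simp [Algebra.algebraMap_eq_smul_one]
  map_star' g := by
    rw [ContinuousLinearMap.star_eq_adjoint, ContinuousLinearMap.eq_adjoint_iff]
    intro f f'
    rw [lp.inner_eq_tsum, lp.inner_eq_tsum]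
    refine tsum_congr fun i => ?_
    simp only [RCLike.inner_apply, lp.mapCLM_apply_coe, lp.star_apply, RCLike.star_def, smul_apply,
      ContinuousLinearMap.id_apply, smul_eq_mul, map_mul, RingHomCompTriple.comp_apply,
      RingHom.id_apply]
    ring

theorem diagonal_apply_apply (g : lp (fun _ : ι => ℂ) ∞) (f : lp (fun _ : ι => ℂ) 2) (i : ι) :
    diagonal ι g f i = g i * f i := rfl

theorem diagonal_injective : Function.Injective (diagonal ι) := by
  classical
  intro g h hgh
  ext i
  simpa [diagonal_apply_apply] using congr($hgh (lp.single 2 i 1) i)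

theorem norm_diagonal (g : lp (fun _ : ι => ℂ) ∞) : ‖diagonal ι g‖ = ‖g‖ :=
  NonUnitalStarAlgHom.norm_map (diagonal ι) diagonal_injective g

/-- The `*`-homomorphism into `ℓ^∞` evaluating at a family of characters. -/
def evalCharacters (t : ι → WeakDual.characterSpace ℂ C) : C →⋆ₐ[ℂ] lp (fun _ : ι => ℂ) ∞ where
  toFun c := ⟨fun i => t i c, memℓp_infty
    ⟨‖c‖, by rintro _ ⟨i, rfl⟩; exact NonUnitalStarAlgHom.norm_apply_le (t i) c⟩⟩
  map_one' := by ext i; simp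
  map_mul' c d := by ext i; simp
  map_zero' := by ext i; simp
  map_add' c d := by ext i; exact map_add (t i) c d
  commutes' r := by ext i; simp [Algebra.algebraMap_eq_smul_one]
  map_star' c := by ext i; simp [map_star]

/-- The linear map into `ℓ^∞` evaluating at a family of contractive functionals. -/
def evalFunctionals (θ : ι → StrongDual ℂ Z) (hθ : ∀ i, ‖θ i‖ ≤ 1) :
    Z →ₗ[ℂ] lp (fun _ : ι => ℂ) ∞ where
  toFun z := ⟨fun i => θ i z, memℓp_infty
    ⟨1 * ‖z‖, by rintro _ ⟨i, rfl⟩; exact (θ i).le_of_opNorm_le (hθ i) z⟩⟩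
  map_add' z w := by ext i; exact map_add (θ i) z w
  map_smul' r z := by ext i; simp

theorem norm_evalFunctionals {θ : ι → StrongDual ℂ Z} (hθ : ∀ i, ‖θ i‖ ≤ 1)
    (h : ∀ z ≠ 0, ∃ i, θ i z = ‖z‖) (z : Z) : ‖evalFunctionals θ hθ z‖ = ‖z‖ := by
  refine le_antisymm (lp.norm_le_of_forall_le (norm_nonneg z) fun i =>
    ((θ i).le_of_opNorm_le (hθ i) z).trans_eq (one_mul _)) ?_
  rcases eq_or_ne z 0 with rfl | hz
  · simp
  obtain ⟨i, hi⟩ := h z hz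
  calc ‖z‖ = ‖θ i z‖ := by rw [hi, Complex.norm_real, norm_norm]
    _ ≤ ‖evalFunctionals θ hθ z‖ :=
      lp.norm_apply_le_norm ENNReal.top_ne_zero (evalFunctionals θ hθ z) i

variable [Module C Z]

theorem evalFunctionals_smul {θ : ι → StrongDual ℂ Z} (hθ : ∀ i, ‖θ i‖ ≤ 1)
    {t : ι → WeakDual.characterSpace ℂ C} (ht : ∀ i, IsEquivariant (t i) (θ i)) (c : C) (z : Z) :
    evalFunctionals θ hθ (c • z) = evalCharacters t c * evalFunctionals θ hθ z :=
  lp.ext (funext fun i => ht i c z)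

theorem isRepresentable_of_forall_exists_isEquivariant {C : Type uC} {Z : Type uX}
    [CommCStarAlgebra C] [NormedAddCommGroup Z] [NormedSpace ℂ Z] [Module C Z] [Module Cᵐᵒᵖ Z]
    [IsCentralScalar C Z]
    (h : ∀ z : Z, z ≠ 0 → ∃ (t : WeakDual.characterSpace ℂ C) (θ : StrongDual ℂ Z),
      ‖θ‖ ≤ 1 ∧ IsEquivariant t θ ∧ θ z = ‖z‖) :
    IsRepresentable.{max uC uX} C C Z := by
  let I := {p : WeakDual.characterSpace ℂ C × StrongDual ℂ Z // ‖p.2‖ ≤ 1 ∧ IsEquivariant p.1 p.2}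
  let π : C →⋆ₐ[ℂ] (lp (fun _ : I => ℂ) 2 →L[ℂ] lp (fun _ : I => ℂ) 2) :=
    (diagonal I).comp (evalCharacters fun i => i.1.1)
  have hI (i : I) : ‖i.1.2‖ ≤ 1 := i.2.1
  let Φ : Z →ₗᵢ[ℂ] (lp (fun _ : I => ℂ) 2 →L[ℂ] lp (fun _ : I => ℂ) 2) :=
    { toLinearMap := (diagonal I).toAlgHom.toLinearMap ∘ₗ evalFunctionals (fun i : I => i.1.2) hI
      norm_map' := fun z => (norm_diagonal _).trans <| norm_evalFunctionals hI (fun z hz => by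
        obtain ⟨t, θ, hθ, ht, hθz⟩ := h z hz
        exact ⟨⟨(t, θ), hθ, ht⟩, hθz⟩) z }
  have hΦ (c : C) (z : Z) : Φ (c • z) = π c ∘L Φ z :=
    (congrArg (diagonal I) (evalFunctionals_smul hI (fun i => i.2.2) c z)).trans (map_mul _ _ _)
  refine ⟨_, _, _, inferInstance, _, _, _, inferInstance, π, π, Φ, hΦ, fun c z => ?_⟩
  rw [op_smul_eq_smul, hΦ]
  exact ((Commute.all _ _).map (diagonal I)).eq

end DiagonalRepresentation

section FiberFunctionals

variable {C X Y E : Type*} [CommCStarAlgebra C] {t : WeakDual.characterSpace ℂ C}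
  [NormedAddCommGroup X] [NormedSpace ℂ X] [Module C X]
  [NormedAddCommGroup Y] [NormedSpace ℂ Y] [Module C Y]
  [NormedAddCommGroup E] [NormedSpace ℂ E]

theorem IsEquivariant.fiberKer_le_ker {f : X →L[ℂ] E} (hf : IsEquivariant t f) :
    fiberKer C X t ≤ f.ker := by
  refine Submodule.topologicalClosure_minimal _ (Submodule.span_le.2 ?_) f.isClosed_ker
  rintro _ ⟨c, x, hc, rfl⟩
  exact (hf c x).trans (by rw [hc, zero_smul])

/-- The map on the fibre `X(t)` induced by an equivariant map along `t`. -/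
def fiberLift {f : X →L[ℂ] E} (hf : IsEquivariant t f) : Fiber C X t →L[ℂ] E :=
  (fiberKer C X t).liftQL f hf.fiberKer_le_ker

theorem norm_fiberLift_le {f : X →L[ℂ] E} (hf : IsEquivariant t f) : ‖fiberLift hf‖ ≤ ‖f‖ :=
  opNorm_le_opNorm_comp_mkQL (S := fiberKer C X t) (fiberLift hf)

theorem IsEquivariant.fiberLift {B : X →L[ℂ] Y →L[ℂ] E} (hB : IsEquivariant t B)
    (hB' : IsEquivariant t B.flip) (ξ : Fiber C X t) :
    IsEquivariant t (CentralBimodule.fiberLift hB ξ) := fun c y => by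
  obtain ⟨x, rfl⟩ := Submodule.mkQ_surjective _ ξ
  exact congr($(hB' c y) x)

/-- The bilinear map on the fibres `X(t)`, `Y(t)` induced by a bilinear map that is equivariant
along `t` in both variables. -/
def fiberBilin {B : X →L[ℂ] Y →L[ℂ] E} (hB : IsEquivariant t B) (hB' : IsEquivariant t B.flip) :
    Fiber C X t →ₗ[ℂ] Fiber C Y t →ₗ[ℂ] E :=
  LinearMap.mk₂ ℂ (fun ξ η => fiberLift (hB.fiberLift hB' ξ) η)
    (fun ξ ξ' η => by
      obtain ⟨y, rfl⟩ := Submodule.mkQ_surjective _ η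
      exact congr($(map_add (fiberLift hB) ξ ξ') y))
    (fun r ξ η => by
      obtain ⟨y, rfl⟩ := Submodule.mkQ_surjective _ η
      exact congr($(map_smul (fiberLift hB) r ξ) y))
    (fun ξ => map_add _) (fun r ξ => map_smul _ r)

theorem fiberBilin_toFiber {B : X →L[ℂ] Y →L[ℂ] E} (hB : IsEquivariant t B)
    (hB' : IsEquivariant t B.flip) (x : X) (y : Y) :
    fiberBilin hB hB' (toFiber C t x) (toFiber C t y) = B x y := rfl

theorem norm_fiberBilin_le {B : X →L[ℂ] Y →L[ℂ] E} (hB : IsEquivariant t B)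
    (hB' : IsEquivariant t B.flip) (ξ : Fiber C X t) (η : Fiber C Y t) :
    ‖fiberBilin hB hB' ξ η‖ ≤ ‖B‖ * ‖ξ‖ * ‖η‖ :=
  (fiberLift (hB.fiberLift hB' ξ)).le_of_opNorm_le ((norm_fiberLift_le _).trans
    ((fiberLift hB).le_of_opNorm_le (norm_fiberLift_le hB) ξ)) η

variable [Module Cᵐᵒᵖ X] [IsScalarTower ℂ C X] [IsBoundedSMul C X] [IsCentralScalar C X]
  [Module Cᵐᵒᵖ Y] [IsScalarTower ℂ C Y] [IsBoundedSMul C Y] [IsCentralScalar C Y]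

theorem IsEquivariant.norm_apply_le_norm_kappaAt [CompleteSpace E] {f : ModTensor C X Y →L[ℂ] E}
    (hf : IsEquivariant t f) (z : ModTensor C X Y) : ‖f z‖ ≤ ‖f‖ * ‖kappaAt t z‖ := by
  have hB : IsEquivariant t (toBilin f) := fun c x => by
    ext y
    exact (congrArg f (leftMul_mtmul c x y)).symm.trans (hf c _)
  have hB' : IsEquivariant t (toBilin f).flip := fun c y => by
    ext x
    change f (mtmul C x (c • y)) = t c • f (mtmul C x y)
    rw [← hf, ← one_smul C x, mtmul_smul_smul, one_mul, one_smul]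
  let F : ProjTensor (Fiber C X t) (Fiber C Y t) →L[ℂ] E :=
    ptlift (fiberBilin hB hB') (norm_nonneg (toBilin f)) (norm_fiberBilin_le hB hB')
  have hfactor : f = F ∘L kappaAt t := modTensor_ext fun x y =>
    calc f (mtmul C x y) = fiberBilin hB hB' (toFiber C t x) (toFiber C t y) :=
        (fiberBilin_toFiber hB hB' x y).symm
      _ = F (ptmul (toFiber C t x) (toFiber C t y)) := (ptlift_ptmul ..).symm
      _ = F (kappaAt t (mtmul C x y)) := congrArg F (kappa_mtmul C X Y x y t).symm
  calc ‖f z‖ = ‖F (kappaAt t z)‖ := congr(‖$hfactor z‖)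
    _ ≤ ‖f‖ * ‖kappaAt t z‖ :=
      F.le_of_opNorm_le ((norm_ptlift_le ..).trans_eq (norm_toBilin f)) _

end FiberFunctionals

section Main

variable {C X Y : Type*} [CommCStarAlgebra C] [NormedAddCommGroup X] [NormedSpace ℂ X]
  [Module C X] [Module Cᵐᵒᵖ X] [IsScalarTower ℂ C X] [IsBoundedSMul C X] [IsCentralScalar C X]
  [NormedAddCommGroup Y] [NormedSpace ℂ Y] [Module C Y] [Module Cᵐᵒᵖ Y] [IsScalarTower ℂ C Y]
  [IsBoundedSMul C Y] [IsCentralScalar C Y]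

theorem IsBallConvex.modTensor [PartialOrder C] [StarOrderedRing C] (hX : IsBallConvex C X)
    (hY : IsBallConvex C Y) : IsBallConvex C (ModTensor C X Y) :=
  isBallConvex_of_sq fun _ hc0 hc1 _ _ => norm_sq_smul_add_sq_smul_le_one hX hY hc0 hc1

theorem IsRepresentable.exists_isEquivariant_modTensor_apply_eq_norm (hX : IsRepresentable C C X)
    (hY : IsRepresentable C C Y) {z : ModTensor C X Y} (hz : z ≠ 0) :
    ∃ (t : WeakDual.characterSpace ℂ C) (θ : StrongDual ℂ (ModTensor C X Y)),
      ‖θ‖ ≤ 1 ∧ IsEquivariant t θ ∧ θ z = ‖z‖ := by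
  let _ : PartialOrder C := CStarAlgebra.spectralOrder C
  have : StarOrderedRing C := CStarAlgebra.spectralOrderedRing C
  exact (hX.isBallConvex.modTensor hY.isBallConvex).exists_isEquivariant_apply_eq_norm hz

theorem norm_kappa_eq_of_le_norm_kappaAt {z : ModTensor C X Y} {t : WeakDual.characterSpace ℂ C}
    (h : ‖z‖ ≤ ‖kappaAt t z‖) : ‖kappa C X Y z‖ = ‖z‖ :=
  le_antisymm (lp.norm_le_of_forall_le (norm_nonneg z) fun t => norm_kappaAt_le t z)
    (h.trans (lp.norm_apply_le_norm ENNReal.top_ne_zero (kappa C X Y z) t))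

end Main

end

end CentralBimodule

theorem mainTheorem4_general
    (C : Type uC) [CommCStarAlgebra C]
    (X : Type uX) [NormedAddCommGroup X] [NormedSpace ℂ X]
    [Module C X] [Module Cᵐᵒᵖ X] [IsScalarTower ℂ C X] [IsBoundedSMul C X] [IsCentralScalar C X]
    (Y : Type uY) [NormedAddCommGroup Y] [NormedSpace ℂ Y]
    [Module C Y] [Module Cᵐᵒᵖ Y] [IsScalarTower ℂ C Y] [IsBoundedSMul C Y] [IsCentralScalar C Y]
    (hX : CentralBimodule.IsRepresentable.{w₁} C C X)
    (hY : CentralBimodule.IsRepresentable.{w₂} C C Y) :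
    Isometry (CentralBimodule.kappa C X Y) ∧
      CentralBimodule.IsRepresentable.{max uC uX uY} C C (CentralBimodule.ModTensor C X Y) := by
  refine ⟨AddMonoidHomClass.isometry_of_norm _ fun z => ?_,
    CentralBimodule.isRepresentable_of_forall_exists_isEquivariant fun _ =>
      hX.exists_isEquivariant_modTensor_apply_eq_norm hY⟩
  rcases eq_or_ne z 0 with rfl | hz
  · rw [map_zero, norm_zero, norm_zero]
  obtain ⟨t, θ, hθ1, hθ, hθz⟩ := hX.exists_isEquivariant_modTensor_apply_eq_norm hY hz
  refine CentralBimodule.norm_kappa_eq_of_le_norm_kappaAt (t := t) ?_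
  calc ‖z‖ = ‖θ z‖ := by rw [hθz, Complex.norm_real, norm_norm]
    _ ≤ ‖θ‖ * ‖CentralBimodule.kappaAt t z‖ := hθ.norm_apply_le_norm_kappaAt z
    _ ≤ ‖CentralBimodule.kappaAt t z‖ := mul_le_of_le_one_left (norm_nonneg _) hθ1

theorem mainTheorem4
    (C : Type uC) [CommCStarAlgebra C]
    (X : Type uX) [NormedAddCommGroup X] [NormedSpace ℂ X] [CompleteSpace X]
    [Module C X] [Module Cᵐᵒᵖ X] [IsScalarTower ℂ C X] [IsBoundedSMul C X] [IsCentralScalar C X]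
    (Y : Type uY) [NormedAddCommGroup Y] [NormedSpace ℂ Y] [CompleteSpace Y]
    [Module C Y] [Module Cᵐᵒᵖ Y] [IsScalarTower ℂ C Y] [IsBoundedSMul C Y] [IsCentralScalar C Y]
    (hX : CentralBimodule.IsRepresentable.{w₁} C C X)
    (hY : CentralBimodule.IsRepresentable.{w₂} C C Y) :
    Isometry (CentralBimodule.kappa C X Y) ∧
      CentralBimodule.IsRepresentable.{max uC uX uY} C C (CentralBimodule.ModTensor C X Y) :=
  mainTheorem4_general C X Y hX hY
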